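/- A measure space here is a triple $(X,\mathcal B_X,\mu)$ with $\mathcal B_X$ a $\sigma$-algebra on $X$ and $\mu$ a finite measure with $\mu(X)>0$; it is a Polish measure space if $X$ is a Polish space and $\mathcal B_X$ its Borel $\sigma$-algebra. The measure algebra $\mathcal M_X$ is the set of classes of sets in $\mathcal B_X$ modulo $A\sim B\iff\mu(A\mathbin{\triangle}B)=0$; union, complement and measure of classes are computed on representatives, and $0$ denotes the class of null sets. A measure algebra map $S:\mathcal M_Y\to\mathcal M_X$ is a map with $S(Y)=X$, $S(0)=0$, $S(B_1\cup B_2)=S(B_1)\cup S(B_2)$, $S(Y\setminus B)=X\setminus S(B)$ and $\mu(S(B))=\nu(B)$ for all $B,B_1,B_2\in\mathcal M_Y$; it is a measure algebra isomorphism if it has an inverse $\mathcal M_X\to\mathcal M_Y$ that is also a measure algebra map. A measure space map $T:(X,\mathcal B_X,\mu)\to(Y,\mathcal B_Y,\nu)$ is a measurable map $T:X\to Y$ with $\mu(T^{-1}(B))=\nu(B)$ for all $B\in\mathcal B_Y$; it induces $T^*:\mathcal M_Y\to\mathcal M_X$, sending the class of $B$ to the class of $T^{-1}(B)$. It is a measure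 space isomorphism if there is a measure space map $\hat T:(Y,\mathcal B_Y,\nu)\to(X,\mathcal B_X,\mu)$ with $\hat T\circ T=\mathrm{id}_X$ $\mu$-a.e. and $T\circ\hat T=\mathrm{id}_Y$ $\nu$-a.e. Let $(X,\mathcal B_X,\mu)$ and $(Y,\mathcal B_Y,\nu)$ be Polish measure spaces with $X$ and $Y$ uncountable. (a) If $S:\mathcal M_Y\to\mathcal M_X$ is a measure algebra isomorphism, then there exists a measure space isomorphism $T:(X,\mathcal B_X,\mu)\to(Y,\mathcal B_Y,\nu)$ with $T^*=S$. (b) If $T:(X,\mathcal B_X,\mu)\to(Y,\mathcal B_Y,\nu)$ is a measure space map such that $T^*$ is a measure algebra isomorphism, then $T$ is a measure space isomorphism. -/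

import Mathlib

open MeasureTheory
open scoped symmDiff ENNReal

/-- The measure algebra of `μ`: the metric space associated with the pseudo-metric
`d(A, B) = μ (A ∆ B)` on the measurable sets (`MeasuredSets μ` is the type of measurable sets with
this pseudo-metric). Its points are the classes of measurable sets that differ by a null set,
see `MeasureAlgebra.mk_eq_mk`. -/
abbrev MeasureAlgebra {X : Type*} [MeasurableSpace X] (μ : Measure X) : Type _ :=
  SeparationQuotient (MeasuredSets μ)

namespace MeasureAlgebra

theorem inseparable_iff {X : Type*} [MeasurableSpace X] {μ : Measure X} (A B : MeasuredSets μ) :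
    Inseparable A B ↔ (A : Set X) =ᵐ[μ] (B : Set X) := by
  rw [EMetric.inseparable_iff, MeasuredSets.edist_def, measure_symmDiff_eq_zero_iff]

/-- A measurable set as a point of the pseudo-metric space `MeasuredSets μ`. -/
def ofSet {X : Type*} [MeasurableSpace X] (μ : Measure X) (A : Set X) (hA : MeasurableSet A) :
    MeasuredSets μ :=
  ⟨A, hA⟩

/-- The class of a measurable set in the measure algebra. -/
noncomputable def mk {X : Type*} [MeasurableSpace X] (μ : Measure X) (A : Set X) (hA : MeasurableSet A) :
    MeasureAlgebra μ :=
  SeparationQuotient.mk (ofSet μ A hA)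

theorem mk_eq_mk {X : Type*} [MeasurableSpace X] {μ : Measure X} {A B : Set X}
    (hA : MeasurableSet A) (hB : MeasurableSet B) :
    mk μ A hA = mk μ B hB ↔ μ (A ∆ B) = 0 := by
  rw [mk, mk, SeparationQuotient.mk_eq_mk, inseparable_iff, ← measure_symmDiff_eq_zero_iff]
  rfl

/-- The class of null sets. -/
noncomputable def zero {X : Type*} [MeasurableSpace X] (μ : Measure X) : MeasureAlgebra μ :=
  mk μ ∅ MeasurableSet.empty

/-- The class of the whole space. -/
noncomputable def one {X : Type*} [MeasurableSpace X] (μ : Measure X) : MeasureAlgebra μ :=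
  mk μ Set.univ MeasurableSet.univ

/-- The union of two classes, computed on representatives. -/
noncomputable def union {X : Type*} [MeasurableSpace X] {μ : Measure X} :
    MeasureAlgebra μ → MeasureAlgebra μ → MeasureAlgebra μ :=
  SeparationQuotient.lift₂
    (fun A B : MeasuredSets μ => mk μ ((A : Set X) ∪ (B : Set X)) (A.2.union B.2))
    (fun A B A' B' h h' => SeparationQuotient.mk_eq_mk.2 <| (inseparable_iff _ _).2 <|
      ((inseparable_iff A A').1 h).union ((inseparable_iff B B').1 h'))

/-- The complement of a class, computed on representatives. -/
noncomputable def compl {X : Type*} [MeasurableSpace X] {μ : Measure X} :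
    MeasureAlgebra μ → MeasureAlgebra μ :=
  SeparationQuotient.lift (fun A : MeasuredSets μ => mk μ (A : Set X)ᶜ A.2.compl)
    (fun A B h => SeparationQuotient.mk_eq_mk.2 <| (inseparable_iff _ _).2 <|
      ((inseparable_iff A B).1 h).compl)

/-- The measure of a class, computed on representatives. -/
noncomputable def measure {X : Type*} [MeasurableSpace X] {μ : Measure X} :
    MeasureAlgebra μ → ℝ≥0∞ :=
  SeparationQuotient.lift (fun A : MeasuredSets μ => μ (A : Set X))
    (fun A B h => measure_congr ((inseparable_iff A B).1 h))

/-- The map `T^*` of measure algebras induced by a measure preserving map `T`: the class of `B` is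
sent to the class of `T ⁻¹' B`. -/
noncomputable def induced {X Y : Type*} [MeasurableSpace X] [MeasurableSpace Y] {μ : Measure X} {ν : Measure Y}
    (T : X → Y) (hT : MeasurePreserving T μ ν) : MeasureAlgebra ν → MeasureAlgebra μ :=
  SeparationQuotient.lift
    (fun B : MeasuredSets ν => mk μ (T ⁻¹' (B : Set Y)) (hT.measurable B.2))
    (fun B B' h => SeparationQuotient.mk_eq_mk.2 <| (inseparable_iff _ _).2 <|
      hT.quasiMeasurePreserving.preimage_ae_eq ((inseparable_iff B B').1 h))

end MeasureAlgebra

/-- Measure algebra maps. -/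
structure IsMeasureAlgebraMap {X Y : Type*} [MeasurableSpace X] [MeasurableSpace Y]
    {μ : Measure X} {ν : Measure Y} (S : MeasureAlgebra ν → MeasureAlgebra μ) : Prop where
  map_one : S (MeasureAlgebra.one ν) = MeasureAlgebra.one μ
  map_zero : S (MeasureAlgebra.zero ν) = MeasureAlgebra.zero μ
  map_union : ∀ B₁ B₂ : MeasureAlgebra ν,
    S (MeasureAlgebra.union B₁ B₂) = MeasureAlgebra.union (S B₁) (S B₂)
  map_compl : ∀ B : MeasureAlgebra ν, S (MeasureAlgebra.compl B) = MeasureAlgebra.compl (S B)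
  measure_map : ∀ B : MeasureAlgebra ν, MeasureAlgebra.measure (S B) = MeasureAlgebra.measure B

/-- Measure algebra isomorphisms: measure algebra maps with an inverse measure algebra map. -/
def IsMeasureAlgebraIso {X Y : Type*} [MeasurableSpace X] [MeasurableSpace Y]
    {μ : Measure X} {ν : Measure Y} (S : MeasureAlgebra ν → MeasureAlgebra μ) : Prop :=
  IsMeasureAlgebraMap S ∧ ∃ R : MeasureAlgebra μ → MeasureAlgebra ν,
    IsMeasureAlgebraMap R ∧ Function.LeftInverse R S ∧ Function.RightInverse R S

/-- Measure space isomorphisms: measure preserving maps `T` with a measure preserving inverse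
modulo null sets. Measure space maps are Mathlib's `MeasurePreserving` maps. -/
structure IsMeasureSpaceIso {X Y : Type*} [MeasurableSpace X] [MeasurableSpace Y]
    (μ : Measure X) (ν : Measure Y) (T : X → Y) : Prop where
  measurePreserving : MeasurePreserving T μ ν
  exists_inverse : ∃ T' : Y → X, MeasurePreserving T' ν μ ∧
    (∀ᵐ x ∂μ, T' (T x) = x) ∧ (∀ᵐ y ∂ν, T (T' y) = y)

namespace MeasureAlgebra

variable {X Y : Type*} [MeasurableSpace X] [MeasurableSpace Y] {μ : Measure X} {ν : Measure Y}

/-! Finite unions and preservation of a finite measure already force a measure algebra map `S` to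
respect countable unions. Embed `Y` in the Cantor space by `φ`, and let `ψ` on `X` have as
coordinates indicators of representatives of the images under `S`. The sets `C` for which `S` sends
`φ ⁻¹' C` to `ψ ⁻¹' C` form a σ-algebra, hence include all Borel sets, and `φ⁻¹ ∘ ψ` induces `S`. If
`S` is invertible, its inverse is also induced by a point map; the two maps are inverse a.e. because
countably many sets separate points. -/

theorem mk_eq_mk_iff_ae_eq {A B : Set X} (hA : MeasurableSet A) (hB : MeasurableSet B) :
    mk μ A hA = mk μ B hB ↔ A =ᵐ[μ] B := by
  rw [mk_eq_mk, measure_symmDiff_eq_zero_iff]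

theorem exists_eq_mk (a : MeasureAlgebra μ) : ∃ (A : Set X) (hA : MeasurableSet A), a = mk μ A hA := by
  obtain ⟨A, rfl⟩ := SeparationQuotient.surjective_mk a
  exact ⟨A, A.2, rfl⟩

theorem union_mk {A B : Set X} (hA : MeasurableSet A) (hB : MeasurableSet B) :
    union (mk μ A hA) (mk μ B hB) = mk μ (A ∪ B) (hA.union hB) :=
  rfl

theorem compl_mk {A : Set X} (hA : MeasurableSet A) : compl (mk μ A hA) = mk μ Aᶜ hA.compl :=
  rfl

theorem measure_mk {A : Set X} (hA : MeasurableSet A) : measure (mk μ A hA) = μ A :=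
  rfl

theorem induced_mk {T : X → Y} (hT : MeasurePreserving T μ ν) {B : Set Y} (hB : MeasurableSet B) :
    induced T hT (mk ν B hB) = mk μ (T ⁻¹' B) (hT.measurable hB) :=
  rfl

end MeasureAlgebra

open MeasureAlgebra

/-- `S` sends the class of `B` to the class of `A`. -/
def SendsClass {X Y : Type*} [MeasurableSpace X] [MeasurableSpace Y] {μ : Measure X}
    {ν : Measure Y} (S : MeasureAlgebra ν → MeasureAlgebra μ) (B : Set Y) (A : Set X) : Prop :=
  ∃ (hB : MeasurableSet B) (hA : MeasurableSet A), S (MeasureAlgebra.mk ν B hB) = MeasureAlgebra.mk μ A hA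

namespace SendsClass

variable {X Y : Type*} [MeasurableSpace X] [MeasurableSpace Y] {μ : Measure X} {ν : Measure Y}
  {S : MeasureAlgebra ν → MeasureAlgebra μ} {B B' : Set Y} {A A' : Set X}

theorem exists_right (S : MeasureAlgebra ν → MeasureAlgebra μ) (hB : MeasurableSet B) :
    ∃ A, SendsClass S B A := by
  obtain ⟨A, hA, h⟩ := exists_eq_mk (S (mk ν B hB))
  exact ⟨A, hB, hA, h⟩

theorem ae_eq (h : SendsClass S B A) (h' : SendsClass S B A') : A =ᵐ[μ] A' := by
  obtain ⟨_, hA, h⟩ := h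
  obtain ⟨_, hA', h'⟩ := h'
  exact (mk_eq_mk_iff_ae_eq hA hA').1 (h.symm.trans h')

theorem congr_right (h : SendsClass S B A) (hA' : MeasurableSet A') (hAA' : A =ᵐ[μ] A') :
    SendsClass S B A' := by
  obtain ⟨hB, hA, h⟩ := h
  exact ⟨hB, hA', h.trans ((mk_eq_mk_iff_ae_eq hA hA').2 hAA')⟩

theorem empty (hS : IsMeasureAlgebraMap S) : SendsClass S ∅ ∅ :=
  ⟨.empty, .empty, hS.map_zero⟩

theorem univ (hS : IsMeasureAlgebraMap S) : SendsClass S Set.univ Set.univ :=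
  ⟨.univ, .univ, hS.map_one⟩

theorem compl (hS : IsMeasureAlgebraMap S) (h : SendsClass S B A) : SendsClass S Bᶜ Aᶜ := by
  obtain ⟨hB, hA, h⟩ := h
  exact ⟨hB.compl, hA.compl, by rw [← compl_mk hB, hS.map_compl, h, compl_mk]⟩

theorem union (hS : IsMeasureAlgebraMap S) (h : SendsClass S B A) (h' : SendsClass S B' A') :
    SendsClass S (B ∪ B') (A ∪ A') := by
  obtain ⟨hB, hA, h⟩ := h
  obtain ⟨hB', hA', h'⟩ := h'
  exact ⟨hB.union hB', hA.union hA', by rw [← union_mk hB hB', hS.map_union, h, h', union_mk]⟩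

theorem measure_eq (hS : IsMeasureAlgebraMap S) (h : SendsClass S B A) : μ A = ν B := by
  obtain ⟨hB, hA, h⟩ := h
  rw [← measure_mk hB, ← hS.measure_map, h, measure_mk]

theorem ae_le (hS : IsMeasureAlgebraMap S) (h : SendsClass S B A) (h' : SendsClass S B' A')
    (hBB' : B ⊆ B') : A ≤ᵐ[μ] A' := by
  have hu := h.union hS h'
  rw [Set.union_eq_self_of_subset_left hBB'] at hu
  exact (LE.le.eventuallyLE Set.subset_union_left).trans (hu.ae_eq h').le

theorem accumulate (hS : IsMeasureAlgebraMap S) {B : ℕ → Set Y} {A : ℕ → Set X}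
    (h : ∀ n, SendsClass S (B n) (A n)) (n : ℕ) :
    SendsClass S (Set.accumulate B n) (Set.accumulate A n) := by
  induction n with
  | zero => simpa using h 0
  | succ n ih => simpa only [Set.accumulate_succ] using ih.union hS (h (n + 1))

/-- The union of the `A n` lies a.e. in any representative `C` of the image, and continuity from
below shows that `C` has no larger measure; as `μ` is finite, they agree a.e. -/
theorem iUnion [IsFiniteMeasure μ] (hS : IsMeasureAlgebraMap S) {B : ℕ → Set Y} {A : ℕ → Set X}
    (h : ∀ n, SendsClass S (B n) (A n)) : SendsClass S (⋃ n, B n) (⋃ n, A n) := by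
  have hA : MeasurableSet (⋃ n, A n) := .iUnion fun n => (h n).2.1
  obtain ⟨C, hC⟩ := exists_right S (MeasurableSet.iUnion fun n => (h n).1)
  refine hC.congr_right hA (Filter.EventuallyEq.symm ?_)
  refine ae_eq_of_ae_subset_of_measure_ge ?_ ?_ hA.nullMeasurableSet (measure_ne_top μ C)
  · have hle := ae_all_iff.2 fun n => (h n).ae_le hS hC (Set.subset_iUnion B n)
    filter_upwards [hle] with x hx hxA
    obtain ⟨n, hn⟩ := Set.mem_iUnion.1 hxA
    exact hx n hn
  · rw [hC.measure_eq hS]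
    refine le_of_tendsto (tendsto_measure_iUnion_accumulate (μ := ν) (f := B)) (.of_forall fun n => ?_)
    rw [← (accumulate hS h n).measure_eq hS]
    exact measure_mono (Set.accumulate_subset_iUnion n)

end SendsClass

section Realization

variable {X Y : Type*} [MeasurableSpace X] [MeasurableSpace Y] {μ : Measure X} {ν : Measure Y}

/-- A measure algebra map that a map into the Cantor space realizes on the coordinate sets
is realized on all measurable sets. -/
theorem IsMeasureAlgebraMap.sendsClass_preimage [IsFiniteMeasure μ]
    {S : MeasureAlgebra ν → MeasureAlgebra μ} (hS : IsMeasureAlgebraMap S)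
    {φ : Y → ℕ → Bool} {ψ : X → ℕ → Bool}
    (h : ∀ n, SendsClass S (φ ⁻¹' {c | c n = true}) (ψ ⁻¹' {c | c n = true}))
    {C : Set (ℕ → Bool)} (hC : MeasurableSet C) : SendsClass S (φ ⁻¹' C) (ψ ⁻¹' C) := by
  -- The good sets form a σ-algebra; it contains the coordinate sets, which generate the product
  -- σ-algebra.
  let m : MeasurableSpace (ℕ → Bool) :=
    { MeasurableSet' := fun C => SendsClass S (φ ⁻¹' C) (ψ ⁻¹' C)
      measurableSet_empty := SendsClass.empty hS
      measurableSet_compl := fun _ hC => hC.compl hS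
      measurableSet_iUnion := fun C hC => by
        simpa only [Set.preimage_iUnion] using SendsClass.iUnion hS hC }
  have hm : (MeasurableSpace.pi : MeasurableSpace (ℕ → Bool)) ≤ m :=
    iSup_le fun n => measurable_iff_comap_le.1 (measurable_to_bool (h n))
  exact hm C hC

/-- A measure algebra map from the measure algebra of a standard Borel space is induced by a
point map. -/
theorem IsMeasureAlgebraMap.exists_sendsClass_preimage [StandardBorelSpace Y] [Nonempty Y]
    [IsFiniteMeasure μ] {S : MeasureAlgebra ν → MeasureAlgebra μ} (hS : IsMeasureAlgebraMap S) :
    ∃ T : X → Y, ∀ B, MeasurableSet B → SendsClass S B (T ⁻¹' B) := by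
  classical
  let φ := MeasurableSpace.mapNatBool Y
  have hφ : MeasurableEmbedding φ := (MeasurableSpace.measurable_mapNatBool Y).measurableEmbedding
    (MeasurableSpace.injective_mapNatBool Y)
  have hcoord (n : ℕ) : MeasurableSet {c : ℕ → Bool | c n = true} :=
    (measurable_pi_apply (X := fun _ : ℕ => Bool) n) (measurableSet_singleton true)
  choose A hA using fun n => SendsClass.exists_right S (hφ.measurable (hcoord n))
  let ψ : X → ℕ → Bool := fun x n => decide (x ∈ A n)
  have hpre (n : ℕ) : ψ ⁻¹' {c | c n = true} = A n := by ext x; simp [ψ]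
  have hψ {C : Set (ℕ → Bool)} (hC : MeasurableSet C) : SendsClass S (φ ⁻¹' C) (ψ ⁻¹' C) :=
    hS.sendsClass_preimage (fun n => by rw [hpre]; exact hA n) hC
  have hψm : Measurable ψ := fun C hC => (hψ hC).2.1
  -- The preimage of the range under `φ` is all of `Y`, so its preimage under `ψ` is conull.
  have hrange : ∀ᵐ x ∂μ, ψ x ∈ Set.range φ := by
    have h := hψ hφ.measurableSet_range
    rw [Set.preimage_range] at h
    filter_upwards [((h.ae_eq (SendsClass.univ hS)).mem_iff)] with x hx using hx.2 trivial
  -- Off the range of `φ`, `hφ.invFun` takes an arbitrary constant value; `ψ` lands there only on a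
  -- null set.
  have hinv := hφ.measurable_invFun
  have hTm : Measurable (hφ.invFun ∘ ψ) := hinv.comp hψm
  refine ⟨hφ.invFun ∘ ψ, fun B hB => ?_⟩
  have h := hψ (hφ.measurableSet_image.2 hB)
  rw [Set.preimage_image_eq _ hφ.injective] at h
  refine h.congr_right (hTm hB) (Filter.eventuallyEq_set.2 ?_)
  filter_upwards [hrange] with x hx
  obtain ⟨y, hy⟩ := hx
  simp only [Set.mem_preimage, Function.comp_apply, ← hy, hφ.leftInverse_invFun y,
    hφ.injective.mem_set_image]

theorem IsMeasureAlgebraMap.exists_induced_eq [StandardBorelSpace Y] [Nonempty Y]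
    [IsFiniteMeasure μ] {S : MeasureAlgebra ν → MeasureAlgebra μ} (hS : IsMeasureAlgebraMap S) :
    ∃ (T : X → Y) (hT : MeasurePreserving T μ ν), induced T hT = S := by
  obtain ⟨T, hT⟩ := hS.exists_sendsClass_preimage
  have hTm : Measurable T := fun B hB => (hT B hB).2.1
  refine ⟨T, ⟨hTm, Measure.ext fun B hB => ?_⟩, funext fun b => ?_⟩
  · rw [Measure.map_apply hTm hB, (hT B hB).measure_eq hS]
  · obtain ⟨B, hB, rfl⟩ := exists_eq_mk b
    exact (hT B hB).2.2.symm

/-- Each measurable set agrees a.e. with its preimage under `T' ∘ T`. Applied to a countable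
separating family, this leaves a single null set outside which `T' (T x)` and `x` are not separated.
-/
theorem comp_ae_eq_id_of_induced_induced [MeasurableSpace.CountablySeparated X] {T : X → Y}
    {T' : Y → X} (hT : MeasurePreserving T μ ν) (hT' : MeasurePreserving T' ν μ)
    (h : ∀ a, induced T hT (induced T' hT' a) = a) : ∀ᵐ x ∂μ, T' (T x) = x :=
  Filter.EventuallyEq.of_forall_separating_preimage (f := T' ∘ T) (g := id) MeasurableSet fun A hA =>
    (mk_eq_mk_iff_ae_eq (hT.measurable (hT'.measurable hA)) hA).1 (h (mk μ A hA))

theorem isMeasureSpaceIso_of_isMeasureAlgebraIso [StandardBorelSpace X] [Nonempty X]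
    [MeasurableSpace.CountablySeparated Y] [IsFiniteMeasure ν] {T : X → Y}
    (hT : MeasurePreserving T μ ν) (h : IsMeasureAlgebraIso (induced T hT)) :
    IsMeasureSpaceIso μ ν T := by
  obtain ⟨-, R, hR, hRS, hSR⟩ := h
  obtain ⟨T', hT', rfl⟩ := hR.exists_induced_eq
  exact ⟨hT, T', hT', comp_ae_eq_id_of_induced_induced hT hT' hSR,
    comp_ae_eq_id_of_induced_induced hT' hT hRS⟩

end Realization

theorem corollary3p09 {X Y : Type*}
    [TopologicalSpace X] [PolishSpace X] [MeasurableSpace X] [BorelSpace X] [Uncountable X]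
    [TopologicalSpace Y] [PolishSpace Y] [MeasurableSpace Y] [BorelSpace Y] [Uncountable Y]
    (μ : Measure X) [IsFiniteMeasure μ] (hμ : 0 < μ Set.univ)
    (ν : Measure Y) [IsFiniteMeasure ν] (hν : 0 < ν Set.univ) :
    (∀ S : MeasureAlgebra ν → MeasureAlgebra μ, IsMeasureAlgebraIso S →
      ∃ (T : X → Y) (hT : IsMeasureSpaceIso μ ν T),
        MeasureAlgebra.induced T hT.measurePreserving = S) ∧
    (∀ (T : X → Y) (hT : MeasurePreserving T μ ν),
      IsMeasureAlgebraIso (MeasureAlgebra.induced T hT) → IsMeasureSpaceIso μ ν T) := by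
  refine ⟨fun S hS => ?_, fun T hT h => isMeasureSpaceIso_of_isMeasureAlgebraIso hT h⟩
  obtain ⟨T, hT, rfl⟩ := hS.1.exists_induced_eq
  exact ⟨T, isMeasureSpaceIso_of_isMeasureAlgebraIso hT hS, rfl⟩
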